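/- **Local contextual recommendation.** Let $\mathsf B=\{w\in\mathbb R^d:\|w\|_2\le 1\}$. There is a hidden point $w^*\in\mathsf B$, fixed in advance and unknown to the learner. In each round $t=1,2,\dots$ an adversary, who may adapt to everything that happened in earlier rounds, presents a finite nonempty set of actions $\mathcal X_t\subseteq\mathsf B$. The learner, who may randomize and knows only $\mathcal X_t$ and the transcript of the earlier rounds, recommends a list $L_t\subseteq\mathcal X_t$ with a distinguished (first) element $x_t\in L_t$. The feedback is an action $x_t^{\mathrm{loc}}\in\mathcal X_t$, chosen by the adversary after seeing $L_t$ and $x_t$, with $\langle x_t^{\mathrm{loc}},w^*\rangle\ge\max_{x\in L_t}\langle x,w^*\rangle$. The expected regret after $T$ rounds is $$\mathbb E[\mathrm{Reg}_T]=\mathbb E\Big[\sum_{t=1}^T\big(\max_{x\in\mathcal X_t}\langle x,w^*\rangle-\langle x_t,w^*\rangle\big)\Big],$$ the expectation being over the learner's randomness. (This is at least the regret measured against the best element of $L_t$.) **Corollary 6.2.** There is an absolute constant $C>0$ such that for all integers $d\ge 0$ and $2\le H\le A$ there is an algorithm for local contextual recommendation in $\mathbb R^d$ whose lists satisfy $|L_t|\le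 H$ in every round and which, for every hidden point $w^*\in\mathsf B$, every adversary with $|\mathcal X_t|\le A$ for all $t$, and every number of rounds $T$, satisfies $$\mathbb E[\mathrm{Reg}_T]\le C\cdot\frac{A}{H-1}\cdot\exp(d\log d),$$ where $\exp(0\log 0)=1$. In particular, the bound does not depend on $T$. -/

import Mathlib

/-! # Local contextual recommendation

A hidden point of the Euclidean unit ball, adversarially (and adaptively) chosen finite action sets,
a randomized learner that recommends lists, and feedback that is at least as good for the hidden
point as everything on the list. -/

namespace LocalRec

/-- `d`-dimensional space with its Euclidean inner product and norm. -/
abbrev Vec (d : ℕ) : Type := EuclideanSpace ℝ (Fin d)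

/-- The transcript of one round: the set of available actions, the main (first) recommendation of
the learner, the whole recommended list (as a set, it contains the main recommendation), and the
action reported by the user. -/
structure Round (d : ℕ) where
  actions : Finset (Vec d)
  pick : Vec d
  list : Finset (Vec d)
  feedback : Vec d

/-- What has happened so far; the most recent round comes first. -/
abbrev History (d : ℕ) : Type := List (Round d)

/-- A randomized algorithm for local contextual recommendation in dimension `d` with list size at
most `H`. Given the past and the current action set, it draws a list of at most `H` of the available
actions, together with a distinguished (first) element of that list. It sees neither the hidden
point nor the future, and it is not told the number of rounds. -/
structure Learner (d H : ℕ) where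
  play : History d → Finset (Vec d) → PMF (Vec d × Finset (Vec d))
  pick_mem : ∀ h X, X.Nonempty → ∀ o ∈ (play h X).support, o.1 ∈ o.2
  list_subset : ∀ h X, X.Nonempty → ∀ o ∈ (play h X).support, o.2 ⊆ X
  list_card : ∀ h X, X.Nonempty → ∀ o ∈ (play h X).support, o.2.card ≤ H

/-- An environment: a hidden point of the unit ball, and an adaptive adversary. In each round the
adversary presents between `1` and `A` actions of the unit ball (depending on the past, which
includes the past random choices of the learner), and, once the list has been drawn, reports an
available action that is at least as good for the hidden point as every action on the list. -/
structure Environment (d A : ℕ) where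
  hidden : Vec d
  hidden_ball : ‖hidden‖ ≤ 1
  actions : History d → Finset (Vec d)
  actions_nonempty : ∀ h, (actions h).Nonempty
  actions_ball : ∀ h, ∀ x ∈ actions h, ‖x‖ ≤ 1
  actions_card : ∀ h, (actions h).card ≤ A
  feedback : History d → Vec d → Finset (Vec d) → Vec d
  feedback_mem : ∀ h x L, x ∈ L → L ⊆ actions h → feedback h x L ∈ actions h
  feedback_best : ∀ h x L, x ∈ L → L ⊆ actions h →
    ∀ y ∈ L, inner ℝ y hidden ≤ inner ℝ (feedback h x L) hidden

variable {d A H : ℕ}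

/-- The law of the transcript of the first `T` rounds. The only randomness is the learner's. -/
noncomputable def historyLaw (alg : Learner d H) (env : Environment d A) : ℕ → PMF (History d)
  | 0 => PMF.pure []
  | T + 1 => (historyLaw alg env T).bind fun h =>
      (alg.play h (env.actions h)).map fun o =>
        { actions := env.actions h, pick := o.1, list := o.2,
          feedback := env.feedback h o.1 o.2 } :: h

/-- The loss of a round when the hidden point is `w`: the utility of the best available action
(the supremum is a maximum, the action set being finite and nonempty) minus that of the learner's
main recommendation. -/
noncomputable def roundLoss (w : Vec d) (ρ : Round d) : ℝ :=
  sSup ((fun x : Vec d => inner ℝ x w) '' (ρ.actions : Set (Vec d))) - inner ℝ ρ.pick w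

/-- The regret accumulated along a transcript. -/
noncomputable def regret (w : Vec d) (h : History d) : ℝ := (h.map (roundLoss w)).sum

/-- The expected regret after `T` rounds. (The law of the transcript has finite support, see
`historyLaw_support_finite`, so that the series is a finite sum.) -/
noncomputable def expectedRegret (alg : Learner d H) (env : Environment d A) (T : ℕ) : ℝ :=
  ∑' h : History d, (historyLaw alg env T h).toReal * regret env.hidden h

theorem historyLaw_support_finite (alg : Learner d H) (env : Environment d A) (T : ℕ) :
    (historyLaw alg env T).support.Finite := by
  induction T with
  | zero => simp [historyLaw]
  | succ T ih =>
    rw [historyLaw, PMF.support_bind]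
    refine ih.biUnion fun h _ => ?_
    rw [PMF.support_map]
    refine Set.Finite.image _ ?_
    refine Set.Finite.subset
      (env.actions h ×ˢ (env.actions h).powerset : Finset (Vec d × Finset (Vec d))).finite_toSet ?_
    intro o ho
    have h1 := alg.pick_mem h _ (env.actions_nonempty h) o ho
    have h2 := alg.list_subset h _ (env.actions_nonempty h) o ho
    simp only [Finset.coe_product, Set.mem_prod, Finset.mem_coe, Finset.mem_powerset]
    exact ⟨h2 h1, h2⟩

theorem expectedRegret_summable (alg : Learner d H) (env : Environment d A) (T : ℕ) :
    Summable fun h : History d => (historyLaw alg env T h).toReal * regret env.hidden h := by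
  refine summable_of_hasFiniteSupport ((historyLaw_support_finite alg env T).subset ?_)
  intro h hh
  rw [PMF.mem_support_iff]
  intro h0
  simp [h0] at hh

end LocalRec

/-! The learner picks an action optimal for a guess and lists `H - 1` uniformly random actions (all
of them, if there are fewer) with it. Let `v` be feedback minus pick and `w` the hidden point. Then
`⟨v, guess⟩ ≤ 0` by the choice of the pick, and the gain `⟨v, w⟩` is nonnegative by the feedback
rule. With probability at least `(H - 1) / A` the best action is listed, and then the gain is at
least the loss. Hence the expected loss is at most `A / (H - 1)` times the expected gain
(`mul_roundLoss_le`), and it suffices to bound the total gain along every transcript (`gain_le`).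

That bound is a cutting-plane argument. The guess is the centroid of the slightly thickened set of
points compatible with all cuts. If the gain exceeds `2 ^ (-i)`, the body reaches far beyond its
centroid in direction `v`, so a cap strictly behind the centroid holds an exponentially small share
of the volume (`measure_le_mul_measure_cap`). The share stays comparable after thickening by a
radius proportional to `2 ^ (-i)` (`measure_add_le_of_convex_subset`), and the cut removes the
thickened cap. So the logarithm of the volume at scale `i` drops by a fixed amount
(`logVol_cons_add_le`), unless the scale is finer than the current thickening; such rounds
contribute a geometric series. Thickening bounds the volume from below, so the total drop at scale
`i` is at most linear in `i`, and the weights `2 ^ (-i)` make the sum converge independently of `T`.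
-/

open MeasureTheory
open scoped Pointwise ENNReal

namespace LocalRec

/-! ### Quarter-size copies of a convex set -/

section Homothety

variable {E : Type*} [NormedAddCommGroup E] [InnerProductSpace ℝ E]

theorem homothety_quarter_subset {G : Set E} (hc : Convex ℝ G) {q : E} (hq : q ∈ G) :
    AffineMap.homothety q (1 / 4 : ℝ) '' G ⊆ G := by
  rintro _ ⟨x, hx, rfl⟩
  rw [AffineMap.homothety_eq_lineMap]
  exact hc.lineMap_mem hq hx ⟨by norm_num, by norm_num⟩

theorem inner_homothety_quarter (q p v x : E) :
    inner ℝ v (AffineMap.homothety q (1 / 4 : ℝ) x - p)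
      = 3 / 4 * inner ℝ v (q - p) + 1 / 4 * inner ℝ v (x - p) := by
  rw [AffineMap.homothety_apply]
  simp only [vsub_eq_sub, vadd_eq_add, inner_sub_right, inner_add_right, inner_smul_right]
  ring

end Homothety

/-! ### Reflections and volumes of thickened convex bodies -/

section Volume

variable {E : Type*} [NormedAddCommGroup E] [InnerProductSpace ℝ E] [FiniteDimensional ℝ E]
  [MeasurableSpace E] [BorelSpace E] (μ : Measure E) [μ.IsAddHaarMeasure]

/-- Tonelli: the left side is the total mass of the convolution of two indicators. -/
theorem lintegral_measure_inter_reflect {A B : Set E} (hA : MeasurableSet A)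
    (hB : MeasurableSet B) :
    ∫⁻ z, μ (A ∩ {u | z - u ∈ B}) ∂μ = μ A * μ B := by
  have hm : Measurable fun q : E × E => q.1 - q.2 := by fun_prop
  have h1 : ∀ z, μ (A ∩ {u | z - u ∈ B})
      = ∫⁻ u, A.indicator 1 u * B.indicator (1 : E → ℝ≥0∞) (z - u) ∂μ := by
    intro z
    have hz : MeasurableSet {u | z - u ∈ B} := by
      have : Measurable fun u : E => z - u := by fun_prop
      exact this hB
    rw [← lintegral_indicator_one (hA.inter hz)]
    congr 1
    ext u
    by_cases ha : u ∈ A <;> by_cases hb : z - u ∈ B <;> simp [ha, hb]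
  simp_rw [h1]
  rw [lintegral_lintegral_swap]
  · have h2 : ∀ u, ∫⁻ z, A.indicator 1 u * B.indicator (1 : E → ℝ≥0∞) (z - u) ∂μ
        = A.indicator 1 u * μ B := by
      intro u
      rw [lintegral_const_mul]
      · rw [lintegral_sub_right_eq_self (fun z => B.indicator (1 : E → ℝ≥0∞) z) u,
          lintegral_indicator_one hB]
      · exact (measurable_one.indicator hB).comp (measurable_id.sub_const u)
    simp_rw [h2]
    rw [lintegral_mul_const _ (measurable_one.indicator hA), lintegral_indicator_one hA]
  · refine Measurable.aemeasurable ?_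
    exact ((measurable_one.indicator hA).comp measurable_snd).mul
      ((measurable_one.indicator hB).comp hm)

/-- Some point reflection of a convex body meets the body in a large part of it. -/
theorem exists_measure_inter_reflect_ge {K : Set E} (hK : IsCompact K) (hc : Convex ℝ K) :
    ∃ z, μ K ≤ 2 ^ Module.finrank ℝ E * μ (K ∩ {u | z - u ∈ K}) := by
  -- Averaging over `z`: the intersections have total integral `μ K ^ 2` and are empty unless `z ∈ K
  -- + K = 2K`, a set of volume `2 ^ n * μ K`.
  by_contra! hlt
  have h0 : μ K ≠ 0 := fun h0 => by simpa [h0] using hlt 0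
  have htop : μ K ≠ ∞ := hK.measure_lt_top.ne
  have hD0 : (2 : ℝ≥0∞) ^ Module.finrank ℝ E ≠ 0 := by simp
  have hDt : (2 : ℝ≥0∞) ^ Module.finrank ℝ E ≠ ∞ := by simp
  have hvol : μ (K + K) = 2 ^ Module.finrank ℝ E * μ K := by
    have : K + K = (2 : ℝ) • K := by
      have := hc.add_smul (p := 1) (q := 1) zero_le_one zero_le_one
      rw [one_smul] at this
      rw [← this]; norm_num
    rw [this, Measure.addHaar_smul, abs_of_nonneg (by positivity), ENNReal.ofReal_pow (by norm_num)]
    simp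
  have hKK : IsCompact (K + K) := hK.add hK
  have hint := lintegral_measure_inter_reflect μ hK.measurableSet hK.measurableSet
  have hsupp : ∫⁻ z, μ (K ∩ {u | z - u ∈ K}) ∂μ
      = ∫⁻ z in K + K, μ (K ∩ {u | z - u ∈ K}) ∂μ := by
    rw [← lintegral_indicator hKK.measurableSet]
    congr 1
    ext z
    by_cases hz : z ∈ K + K
    · simp [hz]
    · have : K ∩ {u | z - u ∈ K} = ∅ := by
        ext u
        simp only [Set.mem_inter_iff, Set.mem_ofPred_eq, Set.mem_empty_iff_false, iff_false, not_and]
        intro hu hzu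
        exact hz ⟨u, hu, z - u, hzu, add_sub_cancel u z⟩
      simp [hz, this]
  have hlt' : ∀ z, μ (K ∩ {u | z - u ∈ K}) < μ K / 2 ^ Module.finrank ℝ E := by
    intro z
    rw [ENNReal.lt_div_iff_mul_lt (Or.inl hD0) (Or.inl hDt), mul_comm]
    exact hlt z
  have hKK0 : μ (K + K) ≠ 0 := by rw [hvol]; exact mul_ne_zero hD0 h0
  have hstrict : ∫⁻ z in K + K, μ (K ∩ {u | z - u ∈ K}) ∂μ
      < ∫⁻ _z in K + K, μ K / 2 ^ Module.finrank ℝ E ∂μ := by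
    refine setLIntegral_strict_mono hKK.measurableSet hKK0 measurable_const ?_ ?_
    · rw [← hsupp, hint]; exact ENNReal.mul_ne_top htop htop
    · exact Filter.Eventually.of_forall fun z _ => hlt' z
  rw [← hsupp, hint, setLIntegral_const, hvol] at hstrict
  refine hstrict.ne ?_
  rw [← mul_assoc, ENNReal.div_mul_cancel hD0 hDt]

/-- A triangle inequality of Ruzsa type. For `y = k + m + z`, the translate `k + S` lies in `G + S`
and, since `S` is symmetric about `z / 2`, also in `y - (M + S)`. Integrate the volume of this
overlap over `y`. -/
theorem measure_add_mul_le {G M S : Set E} (hG : IsCompact G) (hM : IsCompact M)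
    (hS : IsCompact S) {z : E} (hz : ∀ s ∈ S, z - s ∈ S) :
    μ (G + M) * μ S ≤ μ (G + S) * μ (M + S) := by
  rw [← lintegral_measure_inter_reflect μ (hG.add hS).measurableSet (hM.add hS).measurableSet]
  have hGM : IsCompact ((fun x => x + z) '' (G + M)) :=
    (hG.add hM).image (continuous_add_const z)
  calc μ (G + M) * μ S = ∫⁻ _y in (fun x => x + z) '' (G + M), μ S ∂μ := by
        rw [setLIntegral_const, Set.image_add_right, measure_preimage_add_right, mul_comm]
    _ ≤ ∫⁻ y in (fun x => x + z) '' (G + M), μ ((G + S) ∩ {u | y - u ∈ M + S}) ∂μ := by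
        refine setLIntegral_mono' hGM.measurableSet ?_
        rintro _ ⟨_, ⟨k, hk, m, hm, rfl⟩, rfl⟩
        rw [← measure_preimage_add μ (-k) S]
        refine measure_mono ?_
        intro u hu
        have hu' : -k + u ∈ S := hu
        refine ⟨⟨k, hk, -k + u, hu', by simp⟩, m, hm, z - (-k + u), hz _ hu', ?_⟩
        change m + (z - (-k + u)) = k + m + z - u
        abel
    _ ≤ _ := setLIntegral_le_lintegral _ _

/-- If a convex part of a convex body has a given share of its volume, then it keeps a comparable
share after both have been thickened by the same set. -/
theorem measure_add_le_of_convex_subset {G K M : Set E} (hG : IsCompact G) (hGc : Convex ℝ G)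
    (hK : IsCompact K) (hKc : Convex ℝ K) (hM : IsCompact M) (hKG : K ⊆ G) (hG0 : μ G ≠ 0)
    {D : ℝ≥0∞} (hD : μ G ≤ D * μ K) :
    μ (G + M) ≤ 4 ^ Module.finrank ℝ E * D * μ (K + M) := by
  -- The triangle inequality needs a symmetric set, so `K` is replaced by its symmetric core `S`, at
  -- the cost of `2 ^ n`; the other `2 ^ n` comes from `G + S ⊆ 2G`.
  obtain ⟨z, hz⟩ := exists_measure_inter_reflect_ge μ hK hKc
  set S : Set E := K ∩ {u | z - u ∈ K} with hSdef
  have hcl : IsClosed {u | z - u ∈ K} := hK.isClosed.preimage (by fun_prop)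
  have hS : IsCompact S := hK.inter_right hcl
  have hSs : ∀ s ∈ S, z - s ∈ S := fun s hs => ⟨hs.2, by simpa using hs.1⟩
  have hSK : S ⊆ K := Set.inter_subset_left
  have hvol : μ (G + G) = 2 ^ Module.finrank ℝ E * μ G := by
    have : G + G = (2 : ℝ) • G := by
      have := hGc.add_smul (p := 1) (q := 1) zero_le_one zero_le_one
      rw [one_smul] at this
      rw [← this]; norm_num
    rw [this, Measure.addHaar_smul, abs_of_nonneg (by positivity), ENNReal.ofReal_pow (by norm_num)]
    simp
  have hGt : μ G ≠ ∞ := hG.measure_lt_top.ne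
  have h1 := measure_add_mul_le μ hG hM hS hSs
  have h2 : μ (G + S) ≤ 2 ^ Module.finrank ℝ E * μ G :=
    (measure_mono (Set.add_subset_add_left (hSK.trans hKG))).trans_eq hvol
  have h3 : μ (M + S) ≤ μ (K + M) := by
    rw [add_comm]; exact measure_mono (Set.add_subset_add_right hSK)
  have h4 : μ G ≤ D * (2 ^ Module.finrank ℝ E * μ S) := hD.trans (by gcongr)
  refine (ENNReal.mul_le_mul_iff_left hG0 hGt).1 ?_
  calc μ (G + M) * μ G ≤ μ (G + M) * (D * (2 ^ Module.finrank ℝ E * μ S)) := by gcongr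
    _ = D * 2 ^ Module.finrank ℝ E * (μ (G + M) * μ S) := by ring
    _ ≤ D * 2 ^ Module.finrank ℝ E * (2 ^ Module.finrank ℝ E * μ G * μ (K + M)) := by
        exact mul_le_mul_right (h1.trans (mul_le_mul' h2 h3)) _
    _ = _ := by
        rw [show (4 : ℝ≥0∞) = 2 * 2 by norm_num, mul_pow]; ring

/-! ### Caps behind the center of mass -/

/-- The center of mass. -/
noncomputable def centroid (G : Set E) : E := (μ.real G)⁻¹ • ∫ x in G, x ∂μ

theorem setIntegral_inner_sub_centroid {G : Set E} (hG : IsCompact G) (h0 : μ G ≠ 0) (v : E) :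
    ∫ x in G, inner ℝ v (x - centroid μ G) ∂μ = 0 := by
  have hV : μ.real G ≠ 0 := by
    rw [measureReal_def, ENNReal.toReal_ne_zero]; exact ⟨h0, hG.measure_lt_top.ne⟩
  have hi : IntegrableOn (fun x : E => x) G μ := continuous_id.continuousOn.integrableOn_compact hG
  have hc : IntegrableOn (fun _ : E => centroid μ G) G μ :=
    continuous_const.continuousOn.integrableOn_compact hG
  have hs : IntegrableOn (fun x : E => x - centroid μ G) G μ := hi.sub hc
  rw [integral_inner hs, integral_sub hi hc, setIntegral_const, centroid, smul_smul,
    mul_inv_cancel₀ hV, one_smul, sub_self, inner_zero_right]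

theorem measure_homothety_quarter {G : Set E} (q : E) :
    μ (AffineMap.homothety q (1 / 4 : ℝ) '' G) =
      ENNReal.ofReal ((1 / 4) ^ Module.finrank ℝ E) * μ G := by
  rw [Measure.addHaar_image_homothety, abs_of_nonneg (by positivity)]

/-- A half-space that avoids the center of mass at a distance small compared to the extent of the
body on the opposite side still holds an exponentially small share of the volume. -/
theorem measure_le_mul_measure_cap {G : Set E} (hG : IsCompact G) (hGc : Convex ℝ G)
    (h0 : μ G ≠ 0) (v : E) {δ : ℝ} (hδ : 0 < δ) {w : E} (hw : w ∈ G)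
    (hwδ : δ ≤ inner ℝ v (w - centroid μ G)) :
    μ G ≤ 4 ^ (Module.finrank ℝ E + 1) *
      μ {x ∈ G | inner ℝ v (x - centroid μ G) ≤ -((1 / 4) ^ (Module.finrank ℝ E + 1) * δ)} := by
  set p := centroid μ G
  set n := Module.finrank ℝ E
  have hcont : Continuous fun x : E => inner ℝ v (x - p) := by fun_prop
  obtain ⟨y, hy, hmax⟩ := hG.exists_isMaxOn ⟨w, hw⟩ hcont.continuousOn
  set η := inner ℝ v (y - p)
  have hηδ : δ ≤ η := hwδ.trans (hmax hw)
  have hη : 0 < η := hδ.trans_le hηδ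
  have hle : ∀ x ∈ G, inner ℝ v (x - p) ≤ η := fun x hx => hmax hx
  have hGt : μ G ≠ ∞ := hG.measure_lt_top.ne
  have hq0 : (0 : ℝ) < (1 / 4) ^ (n + 1) := by positivity
  have hq1 : (1 / 4 : ℝ) ^ (n + 1) ≤ 1 / 4 := by
    rw [pow_succ]
    have : (1 / 4 : ℝ) ^ n ≤ 1 := pow_le_one₀ (by norm_num) (by norm_num)
    linarith
  set c : ℝ := (1 / 4) ^ (n + 1)
  -- Passing from `δ` to the full extent `η ≥ δ` only shrinks the cap.
  suffices h : μ G ≤ 4 ^ (n + 1) * μ {x ∈ G | inner ℝ v (x - p) ≤ -(c * η)} by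
    refine h.trans ?_
    gcongr 4 ^ (n + 1) * μ ?_
    rintro x ⟨hx, hxη⟩
    exact ⟨hx, hxη.trans (by gcongr)⟩
  set bad : Set E := {x ∈ G | inner ℝ v (x - p) ≤ -(c * η)}
  have hbad : IsCompact bad := hG.inter_right (isClosed_le hcont continuous_const)
  have hscale : (4 : ℝ≥0∞) ^ (n + 1) * ENNReal.ofReal ((1 / 4) ^ (n + 1)) = 1 := by
    rw [ENNReal.ofReal_pow (by norm_num), ← mul_pow, show (4 : ℝ≥0∞) = ENNReal.ofReal 4 by simp,
      ← ENNReal.ofReal_mul (by norm_num)]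
    norm_num
  suffices h : ENNReal.ofReal c * μ G ≤ μ bad by
    calc μ G = 4 ^ (n + 1) * ENNReal.ofReal c * μ G := by rw [hscale, one_mul]
      _ ≤ _ := by rw [mul_assoc]; gcongr
  have hpow : (1 / 4 : ℝ) ^ n = 4 * c := by simp only [c, pow_succ]; ring
  -- If the body extends by `η` on the negative side too, the quarter-size copy at `q` has heights
  -- at most `-η / 2` and lies in the cap.
  by_cases hlow : ∃ q ∈ G, inner ℝ v (q - p) ≤ -η
  · obtain ⟨q, hq, hqη⟩ := hlow
    calc ENNReal.ofReal c * μ G ≤ μ (AffineMap.homothety q (1 / 4 : ℝ) '' G) := by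
          rw [measure_homothety_quarter, hpow]; gcongr; linarith
      _ ≤ μ bad := by
          refine measure_mono fun x hx => ⟨homothety_quarter_subset hGc hq hx, ?_⟩
          obtain ⟨x, hx, rfl⟩ := hx
          rw [inner_homothety_quarter]
          have := hle x hx
          nlinarith
  · push Not at hlow
    set W : Set E := AffineMap.homothety y (1 / 4 : ℝ) '' G
    have hWG : W ⊆ G := homothety_quarter_subset hGc hy
    have hW : IsCompact W := hG.image (AffineMap.homothety_continuous y _)
    have hWvol : μ.real W = 4 * c * μ.real G := by
      rw [measureReal_def, measure_homothety_quarter, ENNReal.toReal_mul,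
        ENNReal.toReal_ofReal (by positivity), hpow, measureReal_def]
    have hWlow : ∀ x ∈ W, η / 2 ≤ inner ℝ v (x - p) := by
      rintro _ ⟨x, hx, rfl⟩
      rw [inner_homothety_quarter]
      have := hlow x hx
      change _ ≤ 3 / 4 * η + _
      linarith
    -- Heights have mean zero. The copy `W` at the top has volume `4 * c * μ G` and heights at least
    -- `η / 2`, contributing `2 * c * η * μ G`; the points outside the cap offset at most half of
    -- this, so the cap, whose heights exceed `-η`, must offset the rest.
    have hpt : ∀ x ∈ G, W.indicator (fun _ => η / 2) x - c * η - bad.indicator (fun _ => η) x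
        ≤ inner ℝ v (x - p) := by
      intro x hx
      have hcη : 0 < c * η := by positivity
      by_cases hxW : x ∈ W
      · have hx1 := hWlow x hxW
        have hxb : 0 ≤ bad.indicator (fun _ => η) x := Set.indicator_nonneg (fun _ _ => hη.le) x
        rw [Set.indicator_of_mem hxW]
        linarith
      · rw [Set.indicator_of_notMem hxW]
        by_cases hxb : x ∈ bad
        · rw [Set.indicator_of_mem hxb]
          linarith [hlow x hx]
        · rw [Set.indicator_of_notMem hxb]
          have : ¬ inner ℝ v (x - p) ≤ -(c * η) := fun h => hxb ⟨hx, h⟩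
          linarith
    have hGc' : ∀ a : ℝ, IntegrableOn (fun _ : E => a) G μ := fun a =>
      continuous_const.continuousOn.integrableOn_compact hG
    have hi1 : IntegrableOn (W.indicator fun _ : E => η / 2) G μ :=
      (hGc' _).indicator hW.measurableSet
    have hi2 : IntegrableOn (bad.indicator fun _ : E => η) G μ :=
      (hGc' _).indicator hbad.measurableSet
    have hi3 : IntegrableOn (fun x => W.indicator (fun _ => η / 2) x - c * η) G μ :=
      hi1.sub (hGc' (c * η))
    have hint := setIntegral_mono_on (hi3.sub hi2)
      (hcont.continuousOn.integrableOn_compact hG) hG.measurableSet hpt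
    rw [setIntegral_inner_sub_centroid μ hG h0 v] at hint
    simp only [Pi.sub_apply] at hint
    rw [integral_sub hi3 hi2, integral_sub hi1 (hGc' (c * η)),
      setIntegral_indicator hW.measurableSet, setIntegral_indicator hbad.measurableSet,
      Set.inter_eq_self_of_subset_right hWG,
      Set.inter_eq_self_of_subset_right (show bad ⊆ G from fun x hx => hx.1)] at hint
    simp only [setIntegral_const, smul_eq_mul] at hint
    rw [hWvol] at hint
    have hkey : c * μ.real G ≤ μ.real bad := by
      have : η * (c * μ.real G) ≤ η * μ.real bad := by linarith
      exact le_of_mul_le_mul_left this hη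
    rw [← ENNReal.toReal_le_toReal (ENNReal.mul_ne_top ENNReal.ofReal_ne_top hGt)
      hbad.measure_lt_top.ne, ENNReal.toReal_mul, ENNReal.toReal_ofReal hq0.le]
    exact hkey

/-- Thickened version of `measure_le_mul_measure_cap`. -/
theorem measure_add_le_mul_measure_cap_add {G M : Set E} (hG : IsCompact G) (hGc : Convex ℝ G)
    (h0 : μ G ≠ 0) (hM : IsCompact M) (v : E) {δ : ℝ} (hδ : 0 < δ) {w : E} (hw : w ∈ G)
    (hwδ : δ ≤ inner ℝ v (w - centroid μ G)) :
    μ (G + M) ≤ 4 * 16 ^ Module.finrank ℝ E *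
      μ ({x ∈ G | inner ℝ v (x - centroid μ G) ≤
        -((1 / 4) ^ (Module.finrank ℝ E + 1) * δ)} + M) := by
  have hcont : Continuous fun x : E => inner ℝ v (x - centroid μ G) := by fun_prop
  refine (measure_add_le_of_convex_subset μ hG hGc
    (hG.inter_right (isClosed_le hcont continuous_const)) ?_ hM Set.inter_subset_left h0
    (measure_le_mul_measure_cap μ hG hGc h0 v hδ hw hwδ)).trans_eq ?_
  · refine hGc.inter ?_
    have : {x : E | inner ℝ v (x - centroid μ G) ≤ -((1 / 4) ^ (Module.finrank ℝ E + 1) * δ)}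
        = {x | innerSL ℝ v x ≤
          inner ℝ v (centroid μ G) - ((1 / 4) ^ (Module.finrank ℝ E + 1) * δ)} := by
      ext x
      simp only [Set.mem_ofPred_eq, inner_sub_right, innerSL_apply_apply]
      constructor <;> intro h <;> linarith
    exact this ▸ convex_halfSpace_le (innerSL ℝ v).toLinearMap.isLinear _
  · rw [show (16 : ℝ≥0∞) = 4 * 4 by norm_num, mul_pow, pow_succ]
    ring_nf
    rfl

end Volume

end LocalRec

namespace LocalRec

/-! ### Cutting planes and the multiscale volume potential -/

section CuttingPlane

variable {d : ℕ}

/-- The direction along which a round reveals information: the feedback minus the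
recommendation. -/
noncomputable def Round.cut (ρ : Round d) : Vec d := ρ.feedback - ρ.pick

/-- The points of the unit ball that are compatible with a transcript. -/
def knowledge (h : History d) : Set (Vec d) :=
  {x | x ∈ Metric.closedBall 0 1 ∧ ∀ ρ ∈ h, 0 ≤ inner ℝ ρ.cut x}

/-- The thickening radius at scale `2 ^ (-i)`. -/
noncomputable def radius (d i : ℕ) : ℝ := (1 / 4) ^ (d + 1) * (1 / 2) ^ i / 8

/-- The compatible points, thickened more and more finely as the transcript grows. -/
noncomputable def body (h : History d) : Set (Vec d) :=
  knowledge h + Metric.closedBall 0 (radius d h.length)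

/-- The guess for the hidden point. -/
noncomputable def guess (h : History d) : Vec d := centroid volume (body h)

/-- The potential at scale `2 ^ (-i)`. -/
noncomputable def logVol (i : ℕ) (h : History d) : ℝ :=
  Real.log (volume.real (knowledge h + Metric.closedBall 0 (radius d h.length + radius d i)))

/-- The transcripts that can occur when the hidden point is `w` and the recommendation is always
optimal for the guess. -/
def Consistent (w : Vec d) : History d → Prop
  | [] => True
  | ρ :: h => Consistent w h ∧ ‖ρ.cut‖ ≤ 2 ∧ inner ℝ ρ.cut (guess h) ≤ 0 ∧ 0 ≤ inner ℝ ρ.cut w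

theorem radius_pos (d i : ℕ) : 0 < radius d i := by unfold radius; positivity

theorem radius_anti (d : ℕ) {i j : ℕ} (hij : i ≤ j) : radius d j ≤ radius d i := by
  unfold radius
  have : (1 / 2 : ℝ) ^ j ≤ (1 / 2) ^ i := pow_le_pow_of_le_one (by norm_num) (by norm_num) hij
  gcongr

theorem radius_le_one (d i : ℕ) : radius d i ≤ 1 := by
  unfold radius
  have h1 : (1 / 4 : ℝ) ^ (d + 1) ≤ 1 := pow_le_one₀ (by norm_num) (by norm_num)
  have h2 : (1 / 2 : ℝ) ^ i ≤ 1 := pow_le_one₀ (by norm_num) (by norm_num)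
  have : (1 / 4 : ℝ) ^ (d + 1) * (1 / 2) ^ i ≤ 1 := mul_le_one₀ h1 (by positivity) h2
  linarith

theorem neg_log_radius_le (d i : ℕ) : -Real.log (radius d i) ≤ 5 + 2 * d + i := by
  have h2 := Real.log_two_lt_d9
  have h4 : Real.log 4 = 2 * Real.log 2 := by
    rw [show (4 : ℝ) = 2 ^ 2 by norm_num, Real.log_pow]; norm_num
  have h8 : Real.log 8 = 3 * Real.log 2 := by
    rw [show (8 : ℝ) = 2 ^ 3 by norm_num, Real.log_pow]; norm_num
  unfold radius
  rw [Real.log_div (by positivity) (by norm_num), Real.log_mul (by positivity) (by positivity),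
    Real.log_pow, Real.log_pow, one_div, one_div, Real.log_inv, Real.log_inv, h4, h8]
  push_cast
  have hd : (0 : ℝ) ≤ d := by positivity
  have hi : (0 : ℝ) ≤ i := by positivity
  nlinarith

theorem knowledge_cons_subset (ρ : Round d) (h : History d) :
    knowledge (ρ :: h) ⊆ knowledge h :=
  fun _ hx => ⟨hx.1, fun σ hσ => hx.2 σ (List.mem_cons_of_mem _ hσ)⟩

theorem knowledge_eq_inter (h : History d) :
    knowledge h = Metric.closedBall 0 1 ∩ ⋂ ρ ∈ h, {x | 0 ≤ inner ℝ ρ.cut x} := by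
  ext x
  simp [knowledge]

theorem isCompact_knowledge (h : History d) : IsCompact (knowledge h) := by
  rw [knowledge_eq_inter]
  refine (isCompact_closedBall 0 1).inter_right ?_
  exact isClosed_iInter fun ρ => isClosed_iInter fun _ =>
    isClosed_le continuous_const (by fun_prop)

theorem convex_knowledge (h : History d) : Convex ℝ (knowledge h) := by
  rw [knowledge_eq_inter]
  refine (convex_closedBall 0 1).inter ?_
  exact convex_iInter fun ρ => convex_iInter fun _ =>
    convex_halfSpace_ge (innerSL ℝ ρ.cut).toLinearMap.isLinear 0

theorem Consistent.mem_knowledge {w : Vec d} (hw : ‖w‖ ≤ 1) :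
    ∀ {h : History d}, Consistent w h → w ∈ knowledge h
  | [], _ => ⟨by simpa using hw, by simp⟩
  | ρ :: h, hc => by
    refine ⟨by simpa using hw, fun σ hσ => ?_⟩
    rcases List.mem_cons.1 hσ with rfl | hσ
    · exact hc.2.2.2
    · exact (hc.1.mem_knowledge hw).2 σ hσ

theorem isCompact_knowledge_add (h : History d) (r : ℝ) :
    IsCompact (knowledge h + Metric.closedBall (0 : Vec d) r) :=
  (isCompact_knowledge h).add (isCompact_closedBall 0 r)

theorem volume_real_closedBall (w : Vec d) {r : ℝ} (hr : 0 ≤ r) :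
    volume.real (Metric.closedBall w r) = r ^ d * volume.real (Metric.ball (0 : Vec d) 1) := by
  rw [measureReal_def, Measure.addHaar_closedBall _ _ hr, ENNReal.toReal_mul,
    ENNReal.toReal_ofReal (by positivity), finrank_euclideanSpace_fin, measureReal_def]

theorem volume_real_ball_pos : 0 < volume.real (Metric.ball (0 : Vec d) 1) :=
  ENNReal.toReal_pos (Metric.measure_ball_pos volume _ one_pos).ne' measure_ball_lt_top.ne

theorem closedBall_subset_add {w : Vec d} {h : History d} (hw : w ∈ knowledge h) (r : ℝ) :
    Metric.closedBall w r ⊆ knowledge h + Metric.closedBall 0 r := by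
  intro x hx
  exact ⟨w, hw, x - w, by simpa [dist_eq_norm] using hx, add_sub_cancel w x⟩

theorem pow_radius_mul_le_volume {w : Vec d} {h : History d} (hw : w ∈ knowledge h) (i : ℕ) :
    radius d i ^ d * volume.real (Metric.ball (0 : Vec d) 1) ≤
      volume.real (knowledge h + Metric.closedBall 0 (radius d h.length + radius d i)) := by
  rw [← volume_real_closedBall w (radius_pos d i).le]
  refine measureReal_mono ?_ (isCompact_knowledge_add h _).measure_lt_top.ne
  refine (Metric.closedBall_subset_closedBall ?_).trans (closedBall_subset_add hw _)
  linarith [radius_pos d h.length]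

theorem volume_pos {w : Vec d} {h : History d} (hw : w ∈ knowledge h) (i : ℕ) :
    0 < volume.real (knowledge h + Metric.closedBall 0 (radius d h.length + radius d i)) :=
  (mul_pos (pow_pos (radius_pos d i) d) volume_real_ball_pos).trans_le
    (pow_radius_mul_le_volume hw i)

/-- The initial set lies in a ball of radius `3`, and the current one contains a ball of radius
`radius d i` about `w`. The `7` is `5` from `neg_log_radius_le` plus `log 3 ≤ 2`. -/
theorem logVol_nil_sub_le {w : Vec d} (hw1 : ‖w‖ ≤ 1) {h : History d} (hw : w ∈ knowledge h)
    (i : ℕ) : logVol i ([] : History d) - logVol i h ≤ d * (7 + 2 * d + i) := by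
  have hV := volume_real_ball_pos (d := d)
  have hr := radius_pos d i
  have hlow : d * Real.log (radius d i) + Real.log (volume.real (Metric.ball (0 : Vec d) 1))
      ≤ logVol i h := by
    rw [← Real.log_pow, ← Real.log_mul (by positivity) hV.ne']
    exact Real.log_le_log (by positivity) (pow_radius_mul_le_volume hw i)
  have hup : logVol i ([] : History d)
      ≤ d * Real.log 3 + Real.log (volume.real (Metric.ball (0 : Vec d) 1)) := by
    rw [← Real.log_pow, ← Real.log_mul (by positivity) hV.ne',
      ← volume_real_closedBall 0 (by norm_num : (0 : ℝ) ≤ 3)]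
    refine Real.log_le_log (volume_pos (w := w) ⟨by simpa using hw1, by simp⟩ i) ?_
    refine measureReal_mono ?_ (isCompact_closedBall _ _).measure_lt_top.ne
    rintro _ ⟨x, hx, y, hy, rfl⟩
    have hx1 := hx.1
    rw [mem_closedBall_zero_iff] at hx1 hy ⊢
    have := norm_add_le x y
    have h1 := radius_le_one d i
    have h2 := radius_le_one d ([] : History d).length
    change ‖x + y‖ ≤ 3
    linarith
  have hlog3 : Real.log 3 ≤ 2 := by
    have := Real.log_le_sub_one_of_pos (by norm_num : (0 : ℝ) < 3); linarith
  have hrl := neg_log_radius_le d i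
  have hd : (0 : ℝ) ≤ d := by positivity
  nlinarith

theorem logVol_cons_le {w : Vec d} {ρ : Round d} {h : History d} (hw : w ∈ knowledge (ρ :: h))
    (i : ℕ) : logVol i (ρ :: h) ≤ logVol i h := by
  refine Real.log_le_log (volume_pos hw i) ?_
  refine measureReal_mono ?_ (isCompact_knowledge_add h _).measure_lt_top.ne
  refine Set.add_subset_add (knowledge_cons_subset ρ h) (Metric.closedBall_subset_closedBall ?_)
  have := radius_anti d (Nat.le_succ h.length)
  simp only [List.length_cons]
  linarith

/-- A round decreases the potential at the scale of its gain by a fixed amount, unless that scale is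
finer than the current thickening. -/
theorem logVol_cons_add_le {w : Vec d} {ρ : Round d} {h : History d}
    (hw : w ∈ knowledge (ρ :: h)) (hcut : ‖ρ.cut‖ ≤ 2) (hguess : inner ℝ ρ.cut (guess h) ≤ 0)
    {i : ℕ} (hi : i ≤ h.length) (hgain : (1 / 2) ^ i < inner ℝ ρ.cut w) :
    logVol i (ρ :: h) + (4 * 16 ^ d)⁻¹ ≤ logVol i h := by
  set v := ρ.cut
  have hwh := knowledge_cons_subset ρ h hw
  have hδ : 0 < inner ℝ v w := lt_trans (by positivity) hgain
  have hri := radius_pos d i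
  have hrt := radius_pos d h.length
  have hG : IsCompact (body h) := isCompact_knowledge_add h _
  have hGc : Convex ℝ (body h) := (convex_knowledge h).add (convex_closedBall 0 _)
  have hwG : w ∈ body h := closedBall_subset_add hwh _ (Metric.mem_closedBall_self hrt.le)
  have hG0 : volume (body h) ≠ 0 := by
    refine ((Metric.measure_closedBall_pos volume w hrt).trans_le
      (measure_mono (closedBall_subset_add hwh _))).ne'
  have hM : IsCompact (Metric.closedBall (0 : Vec d) (radius d i)) := isCompact_closedBall 0 _
  -- As `⟨v, guess⟩ ≤ 0`, the point `w` lies at height at least `⟨v, w⟩` above the centroid.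
  have hshare := measure_add_le_mul_measure_cap_add volume hG hGc hG0 hM v hδ hwG
    (by rw [inner_sub_right]; change _ ≤ _ - inner ℝ v (guess h); linarith)
  have hGM : body h + Metric.closedBall 0 (radius d i)
      = knowledge h + Metric.closedBall 0 (radius d h.length + radius d i) := by
    rw [body, add_assoc, closedBall_add_closedBall hrt.le hri.le, add_zero]
  set cap : Set (Vec d) := {x ∈ body h | inner ℝ v (x - centroid volume (body h)) ≤
        -((1 / 4) ^ (Module.finrank ℝ (Vec d) + 1) * inner ℝ v w)} with hcap
  have hcapC : IsCompact cap := hG.inter_right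
    (isClosed_le (f := fun x : Vec d => inner ℝ v (x - centroid volume (body h)))
      (by fun_prop) continuous_const)
  rw [hGM, finrank_euclideanSpace_fin] at hshare
  set next := knowledge (ρ :: h) +
    Metric.closedBall (0 : Vec d) (radius d (ρ :: h).length + radius d i)
  have hnextC : IsCompact next := isCompact_knowledge_add _ _
  have hsmall : ∀ (x : Vec d) (r : ℝ), x ∈ Metric.closedBall 0 r → |inner ℝ v x| ≤ 2 * r := by
    intro x r hx
    rw [mem_closedBall_zero_iff] at hx
    refine (abs_real_inner_le_norm v x).trans ?_
    have := norm_nonneg x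
    have := norm_nonneg v
    nlinarith
  have hrad : radius d (ρ :: h).length ≤ radius d i :=
    radius_anti d (hi.trans (Nat.le_succ _))
  -- The radius is chosen for this: thickening moves `⟨v, ·⟩` by at most `4 * radius d i` on the
  -- surviving set and `2 * radius d i` on the cap, so a cap deeper than `8 * radius d i` stays
  -- disjoint from it.
  have hδr : 8 * radius d i < (1 / 4) ^ (d + 1) * inner ℝ v w := by
    have : 8 * radius d i = (1 / 4) ^ (d + 1) * (1 / 2) ^ i := by unfold radius; ring
    rw [this]
    gcongr
  have hdisj : Disjoint next (cap + Metric.closedBall 0 (radius d i)) := by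
    rw [Set.disjoint_left]
    rintro _ ⟨x, hx, y, hy, rfl⟩ ⟨x', ⟨-, hx'⟩, y', hy', heq⟩
    have h1 : 0 ≤ inner ℝ v x := hx.2 ρ List.mem_cons_self
    have h2 := (abs_le.1 (hsmall y _ hy)).1
    have h3 := (abs_le.1 (hsmall y' _ hy')).2
    have h4 : inner ℝ v x' + inner ℝ v y' = inner ℝ v x + inner ℝ v y := by
      rw [← inner_add_right, ← inner_add_right]
      exact congrArg _ heq
    rw [inner_sub_right, finrank_euclideanSpace_fin] at hx'
    change _ - inner ℝ v (guess h) ≤ _ at hx'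
    linarith
  have hsub : next ∪ (cap + Metric.closedBall 0 (radius d i))
      ⊆ knowledge h + Metric.closedBall 0 (radius d h.length + radius d i) := by
    refine Set.union_subset ?_ ?_
    · refine Set.add_subset_add (knowledge_cons_subset ρ h)
        (Metric.closedBall_subset_closedBall ?_)
      have := radius_anti d (Nat.le_succ h.length)
      simp only [List.length_cons]
      linarith
    · rw [← hGM]
      exact Set.add_subset_add_right fun x hx => hx.1
  have hbigT : volume (knowledge h + Metric.closedBall 0 (radius d h.length + radius d i)) ≠ ∞ :=
    (isCompact_knowledge_add h _).measure_lt_top.ne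
  have hcM := hcapC.add hM
  have hadd : volume.real next + volume.real (cap + Metric.closedBall 0 (radius d i))
      ≤ volume.real (knowledge h + Metric.closedBall 0 (radius d h.length + radius d i)) := by
    rw [← measureReal_union hdisj hcM.measurableSet hnextC.measure_lt_top.ne
      hcM.measure_lt_top.ne]
    exact measureReal_mono hsub hbigT
  have hshare' : volume.real (knowledge h + Metric.closedBall 0 (radius d h.length + radius d i))
      ≤ 4 * 16 ^ d * volume.real (cap + Metric.closedBall 0 (radius d i)) := by
    have := ENNReal.toReal_mono (ENNReal.mul_ne_top (by finiteness) hcM.measure_lt_top.ne) hshare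
    simpa [measureReal_def, ENNReal.toReal_mul, ENNReal.toReal_pow] using this
  have hnext : 0 < volume.real next := volume_pos hw i
  have hbig := volume_pos hwh i
  unfold logVol
  set g := volume.real (knowledge h + Metric.closedBall 0 (radius d h.length + radius d i))
  set k := volume.real (cap + Metric.closedBall 0 (radius d i))
  set θ : ℝ := (4 * 16 ^ d)⁻¹ with hθ
  have hk : θ * g ≤ k := by
    rw [hθ, inv_mul_le_iff₀ (by positivity)]
    exact hshare'
  have hn : volume.real next ≤ g * (1 - θ) := by linarith
  have h1θ : 0 < 1 - θ := by
    by_contra hneg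
    nlinarith
  change Real.log (volume.real next) + θ ≤ Real.log g
  have := Real.log_le_log hnext hn
  rw [Real.log_mul hbig.ne' h1θ.ne'] at this
  have := Real.log_le_sub_one_of_pos h1θ
  linarith

/-- The total gain along a transcript. -/
noncomputable def gain (w : Vec d) (h : History d) : ℝ :=
  (h.map fun ρ => inner ℝ ρ.cut w).sum

/-- Charges the gain to the potential drop at its own dyadic scale; the other scales only help,
since no potential increases. The cutoff `N` does not depend on the round, so that the sums
telescope. -/
theorem inner_cut_le {w : Vec d} (hw1 : ‖w‖ ≤ 1) {ρ : Round d} {h : History d}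
    (hc : Consistent w (ρ :: h)) {N : ℕ} (hN : h.length < N) :
    inner ℝ ρ.cut w ≤ 2 * (1 / 2) ^ h.length +
      8 * 16 ^ d * ∑ i ∈ Finset.range N, (1 / 2) ^ i * (logVol i h - logVol i (ρ :: h)) := by
  have hw := hc.mem_knowledge hw1
  obtain ⟨-, hcut, hguess, hnn⟩ := hc
  have hterm : ∀ i ∈ Finset.range N, 0 ≤ (1 / 2 : ℝ) ^ i * (logVol i h - logVol i (ρ :: h)) :=
    fun i _ => mul_nonneg (by positivity) (sub_nonneg.2 (logVol_cons_le hw i))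
  by_cases hbig : inner ℝ ρ.cut w ≤ 2 * (1 / 2 : ℝ) ^ h.length
  · have := Finset.sum_nonneg hterm
    have : 0 ≤ 8 * 16 ^ d * ∑ i ∈ Finset.range N,
      (1 / 2 : ℝ) ^ i * (logVol i h - logVol i (ρ :: h)) := by positivity
    linarith
  push Not at hbig
  have hle2 : inner ℝ ρ.cut w ≤ 2 := by
    have := real_inner_le_norm ρ.cut w
    nlinarith [norm_nonneg w, norm_nonneg ρ.cut]
  have hp : (0 : ℝ) < (1 / 2) ^ h.length := by positivity
  -- Halving the gain yields `2 ^ (-i) < gain ≤ 2 * 2 ^ (-i)`, with the strict lower bound that the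
  -- drop requires.
  obtain ⟨i, hi1, hi2⟩ := exists_nat_pow_near_of_lt_one (x := inner ℝ ρ.cut w / 2)
    (y := (1 / 2 : ℝ)) (by linarith) (by linarith) (by norm_num) (by norm_num)
  rw [pow_succ] at hi1
  have hit : i ≤ h.length := by
    by_contra! hlt
    have : (1 / 2 : ℝ) ^ i ≤ (1 / 2) ^ h.length :=
      pow_le_pow_of_le_one (by norm_num) (by norm_num) hlt.le
    linarith
  have hdrop := logVol_cons_add_le hw hcut hguess hit (by linarith)
  have hsingle := Finset.single_le_sum hterm (Finset.mem_range.2 (hit.trans_lt hN))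
  have h16 : (0 : ℝ) < 4 * 16 ^ d := by positivity
  have hpi : (0 : ℝ) < (1 / 2) ^ i := by positivity
  have hone : 1 ≤ 4 * 16 ^ d * (logVol i h - logVol i (ρ :: h)) := by
    rw [← inv_le_iff_one_le_mul₀' h16]; linarith
  calc inner ℝ ρ.cut w ≤ 2 * (1 / 2) ^ i * 1 := by linarith
    _ ≤ 2 * (1 / 2) ^ i * (4 * 16 ^ d * (logVol i h - logVol i (ρ :: h))) := by gcongr
    _ = 8 * 16 ^ d * ((1 / 2) ^ i * (logVol i h - logVol i (ρ :: h))) := by ring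
    _ ≤ 8 * 16 ^ d * ∑ i ∈ Finset.range N, (1 / 2) ^ i * (logVol i h - logVol i (ρ :: h)) := by
        gcongr
    _ ≤ _ := by linarith

theorem gain_le_potential {w : Vec d} (hw1 : ‖w‖ ≤ 1) (N : ℕ) :
    ∀ {h : History d}, Consistent w h → h.length ≤ N →
      gain w h ≤ ∑ t ∈ Finset.range h.length, 2 * (1 / 2 : ℝ) ^ t +
        8 * 16 ^ d * ∑ i ∈ Finset.range N, (1 / 2) ^ i * (logVol i ([] : History d) - logVol i h)
  | [], _, _ => by simp [gain]
  | ρ :: h, hc, hN => by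
    have h1 := gain_le_potential hw1 N hc.1 (Nat.le_of_succ_le hN)
    have h2 := inner_cut_le hw1 hc (N := N) hN
    have h3 : gain w (ρ :: h) = inner ℝ ρ.cut w + gain w h := by simp [gain]
    rw [h3, List.length_cons, Finset.sum_range_succ]
    have h4 : ∑ i ∈ Finset.range N, (1 / 2 : ℝ) ^ i * (logVol i ([] : History d) - logVol i (ρ :: h))
        = ∑ i ∈ Finset.range N, (1 / 2 : ℝ) ^ i * (logVol i ([] : History d) - logVol i h)
          + ∑ i ∈ Finset.range N, (1 / 2 : ℝ) ^ i * (logVol i h - logVol i (ρ :: h)) := by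
      rw [← Finset.sum_add_distrib]
      exact Finset.sum_congr rfl fun i _ => by ring
    rw [h4]
    linarith

theorem sum_half_pow_le (N : ℕ) : ∑ t ∈ Finset.range N, (1 / 2 : ℝ) ^ t ≤ 2 := by
  have h : ∑ t ∈ Finset.range N, (1 / 2 : ℝ) ^ t = 2 - 2 * (1 / 2) ^ N := by
    induction N with
    | zero => norm_num
    | succ n ih => rw [Finset.sum_range_succ, ih, pow_succ]; ring
  rw [h]
  have : (0 : ℝ) < (1 / 2) ^ N := by positivity
  linarith

theorem sum_half_pow_mul_le (N : ℕ) : ∑ t ∈ Finset.range N, (1 / 2 : ℝ) ^ t * t ≤ 2 := by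
  have h : ∑ t ∈ Finset.range N, (1 / 2 : ℝ) ^ t * t = 2 - 2 * (N + 1) * (1 / 2) ^ N := by
    induction N with
    | zero => norm_num
    | succ n ih => rw [Finset.sum_range_succ, ih, pow_succ]; push_cast; ring
  rw [h]
  have : (0 : ℝ) ≤ 2 * (N + 1) * (1 / 2) ^ N := by positivity
  linarith

/-- The weights `2 ^ (-i)` absorb the linear growth of the drops in `i`. In `132 = 4 + 128`, the `4`
pays for the gains below the thickening scale, and the polynomial in `d` is absorbed into `16 * 4 ^
d`. -/
theorem gain_le {w : Vec d} (hw1 : ‖w‖ ≤ 1) {h : History d} (hc : Consistent w h) :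
    gain w h ≤ 132 * 64 ^ d := by
  have h1 := gain_le_potential hw1 h.length hc le_rfl
  have hw := hc.mem_knowledge hw1
  rw [← Finset.mul_sum] at h1
  have h2 := sum_half_pow_le h.length
  have h3 := sum_half_pow_mul_le h.length
  have hd : (0 : ℝ) ≤ d := by positivity
  have h4 : ∑ i ∈ Finset.range h.length, (1 / 2 : ℝ) ^ i * (logVol i ([] : History d) - logVol i h)
      ≤ d * (16 + 4 * d) := by
    calc ∑ i ∈ Finset.range h.length, (1 / 2 : ℝ) ^ i * (logVol i ([] : History d) - logVol i h)
        ≤ ∑ i ∈ Finset.range h.length, (1 / 2 : ℝ) ^ i * (d * (7 + 2 * d + i)) := by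
          gcongr with i _
          exact logVol_nil_sub_le hw1 hw i
      _ = d * (7 + 2 * d) * ∑ i ∈ Finset.range h.length, (1 / 2 : ℝ) ^ i
          + d * ∑ i ∈ Finset.range h.length, (1 / 2 : ℝ) ^ i * i := by
          rw [Finset.mul_sum, Finset.mul_sum, ← Finset.sum_add_distrib]
          exact Finset.sum_congr rfl fun i _ => by ring
      _ ≤ d * (7 + 2 * d) * 2 + d * 2 := by gcongr
      _ = d * (16 + 4 * d) := by ring
  have hd2 : (d : ℝ) ≤ 2 ^ d := by exact_mod_cast Nat.lt_two_pow_self.le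
  have hd3 : (1 : ℝ) ≤ 2 ^ d := one_le_pow₀ (by norm_num)
  have hd4 : (d : ℝ) + 1 ≤ 2 ^ d := by exact_mod_cast Nat.lt_two_pow_self
  have h5 : (d : ℝ) * (16 + 4 * d) ≤ 2 ^ d * (16 * 2 ^ d) := by
    gcongr; linarith
  have h6 : (1 : ℝ) ≤ 64 ^ d := one_le_pow₀ (by norm_num)
  have h64 : (64 : ℝ) ^ d = 16 ^ d * (2 ^ d * 2 ^ d) := by
    rw [← mul_pow, ← mul_pow]; norm_num
  have h7 : 8 * 16 ^ d * ∑ i ∈ Finset.range h.length,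
      (1 / 2 : ℝ) ^ i * (logVol i ([] : History d) - logVol i h) ≤ 8 * 16 ^ d * (2 ^ d * (16 * 2 ^ d)) := by
    gcongr; exact h4.trans h5
  have h8 : 8 * (16 : ℝ) ^ d * (2 ^ d * (16 * 2 ^ d)) = 128 * 64 ^ d := by rw [h64]; ring
  linarith

end CuttingPlane

end LocalRec

namespace LocalRec

/-! ### Random lists, the learner and its expected regret -/

section Learning

variable {d A H : ℕ}

theorem tsum_bind_mul {α β : Type*} (p : PMF α) (f : α → PMF β) (g : β → ℝ≥0∞) :
    ∑' b, p.bind f b * g b = ∑' a, p a * ∑' b, f a b * g b := by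
  simp_rw [PMF.bind_apply, ← ENNReal.tsum_mul_right, ← ENNReal.tsum_mul_left, mul_assoc]
  exact ENNReal.tsum_comm

theorem tsum_map_mul {α β : Type*} (p : PMF α) (f : α → β) (g : β → ℝ≥0∞) :
    ∑' b, p.map f b * g b = ∑' a, p a * g (f a) := by
  classical
  rw [← PMF.bind_pure_comp, tsum_bind_mul]
  refine tsum_congr fun a => ?_
  rw [tsum_eq_single (f a) fun b hb => by simp [hb]]
  simp

theorem mul_card_filter_mem_powersetCard {α : Type*} [DecidableEq α] {X : Finset α} {x : α}
    (hx : x ∈ X) (k : ℕ) :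
    X.card * ((X.powersetCard k).filter (x ∈ ·)).card = k * (X.powersetCard k).card := by
  rcases k with _ | j
  · simp
  have himg : (X.powersetCard (j + 1)).filter (x ∈ ·)
      = ((X.erase x).powersetCard j).image (insert x) := by
    ext R
    simp only [Finset.mem_filter, Finset.mem_powersetCard, Finset.mem_image]
    constructor
    · rintro ⟨⟨hR, hc⟩, hxR⟩
      exact ⟨R.erase x, ⟨Finset.erase_subset_erase x hR, by rw [Finset.card_erase_of_mem hxR, hc]; rfl⟩,
        Finset.insert_erase hxR⟩
    · rintro ⟨S, ⟨hS, hc⟩, rfl⟩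
      have hxS : x ∉ S := fun h => Finset.notMem_erase x X (hS h)
      exact ⟨⟨Finset.insert_subset hx (hS.trans (Finset.erase_subset x X)),
        by rw [Finset.card_insert_of_notMem hxS, hc]⟩, Finset.mem_insert_self x S⟩
  rw [himg, Finset.card_image_of_injOn, Finset.card_powersetCard, Finset.card_powersetCard,
    Finset.card_erase_of_mem hx]
  · obtain ⟨n, hn⟩ : ∃ n, X.card = n + 1 := ⟨X.card - 1, by have := Finset.card_pos.2 ⟨x, hx⟩; omega⟩
    rw [hn, mul_comm (j + 1)]
    exact Nat.add_one_mul_choose_eq n j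
  · intro S hS S' hS' heq
    have h1 : ∀ S ∈ (((X.erase x).powersetCard j : Finset (Finset α)) : Set (Finset α)), x ∉ S :=
      fun S hS h => Finset.notMem_erase x X ((Finset.mem_powersetCard.1 hS).1 h)
    rw [← Finset.erase_insert (h1 S hS), ← Finset.erase_insert (h1 S' hS'), heq]

/-- A uniformly random subset of `X` of size `min k |X|`. -/
noncomputable def randomSubset {α : Type*} (X : Finset α) (k : ℕ) : PMF (Finset α) :=
  PMF.uniformOfFinset (X.powersetCard (min k X.card))
    (Finset.powersetCard_nonempty_of_le (min_le_right _ _))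

theorem mem_support_randomSubset {α : Type*} {X : Finset α} {k : ℕ} {R : Finset α} :
    R ∈ (randomSubset X k).support ↔ R ⊆ X ∧ R.card = min k X.card := by
  rw [randomSubset, PMF.mem_support_uniformOfFinset_iff, Finset.mem_powersetCard]

theorem card_mul_tsum_randomSubset {α : Type*} [DecidableEq α] {X : Finset α} {x : α}
    (hx : x ∈ X) (k : ℕ) :
    (X.card : ℝ≥0∞) * ∑' R, randomSubset X k R * (if x ∈ R then 1 else 0)
      = (min k X.card : ℕ) := by
  set s := X.powersetCard (min k X.card) with hs
  have hs0 : (s.card : ℝ≥0∞) ≠ 0 := by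
    have : s.Nonempty := Finset.powersetCard_nonempty_of_le (min_le_right _ _)
    simpa using this.ne_empty
  have hst : (s.card : ℝ≥0∞) ≠ ∞ := ENNReal.natCast_ne_top _
  have hsum : ∑' R, randomSubset X k R * (if x ∈ R then 1 else 0)
      = (s.filter (x ∈ ·)).card * (s.card : ℝ≥0∞)⁻¹ := by
    rw [tsum_eq_sum (s := s.filter (x ∈ ·))]
    · rw [Finset.sum_congr rfl (g := fun _ => (s.card : ℝ≥0∞)⁻¹), Finset.sum_const, nsmul_eq_mul]
      intro R hR
      rw [Finset.mem_filter] at hR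
      rw [randomSubset, PMF.uniformOfFinset_apply_of_mem _ hR.1, if_pos hR.2, mul_one]
    · intro R hR
      by_cases hxR : x ∈ R
      · rw [randomSubset, PMF.uniformOfFinset_apply_of_notMem, zero_mul]
        exact fun h => hR (Finset.mem_filter.2 ⟨h, hxR⟩)
      · simp [hxR]
  rw [hsum, ← mul_assoc, ← Nat.cast_mul, mul_card_filter_mem_powersetCard hx, Nat.cast_mul,
    mul_assoc, ENNReal.mul_inv_cancel hs0 hst, mul_one]

/-- The inclusion probability is `k / X.card ≥ k / A` if `k ≤ X.card`; otherwise all of `X` is drawn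
and `k ≤ A` suffices. -/
theorem le_mul_tsum_randomSubset {α : Type*} [DecidableEq α] {X : Finset α} {x : α}
    (hx : x ∈ X) {k : ℕ} (hk : k ≤ A) (hX : X.card ≤ A) :
    (k : ℝ≥0∞) ≤ A * ∑' R, randomSubset X k R * (if x ∈ R then 1 else 0) := by
  have h := card_mul_tsum_randomSubset hx k
  rcases le_total k X.card with hle | hle
  · rw [min_eq_left hle] at h
    rw [← h]
    gcongr
  · rw [min_eq_right hle] at h
    have hX0 : (X.card : ℝ≥0∞) ≠ 0 := by
      simpa using Finset.ne_empty_of_mem hx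
    have h1 : ∑' R, randomSubset X k R * (if x ∈ R then 1 else 0) = 1 := by
      rw [← ENNReal.mul_right_inj hX0 (ENNReal.natCast_ne_top _), h, mul_one]
    rw [h1, mul_one]
    exact_mod_cast hk

open Classical in
/-- An action that is optimal for the guess. -/
noncomputable def recommend (h : History d) (X : Finset (Vec d)) : Vec d :=
  if hX : X.Nonempty then
    (X.exists_max_image (fun x => inner ℝ x (guess h)) hX).choose
  -- Never reached in play: environments present nonempty action sets.
  else 0

theorem recommend_mem (h : History d) {X : Finset (Vec d)} (hX : X.Nonempty) :
    recommend h X ∈ X := by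
  rw [recommend, dif_pos hX]
  exact (X.exists_max_image (fun x => inner ℝ x (guess h)) hX).choose_spec.1

theorem inner_guess_le_recommend (h : History d) {X : Finset (Vec d)} {x : Vec d} (hx : x ∈ X) :
    inner ℝ x (guess h) ≤ inner ℝ (recommend h X) (guess h) := by
  rw [recommend, dif_pos ⟨x, hx⟩]
  exact (X.exists_max_image (fun x => inner ℝ x (guess h)) ⟨x, hx⟩).choose_spec.2 x hx

open Classical in
/-- Recommend an optimal action for the guess, and list random other actions with it. -/
noncomputable def guessLearner (d : ℕ) {H : ℕ} (hH : 1 ≤ H) : Learner d H where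
  -- One place is reserved for the pick. `R` is drawn from all of `X`, so every action, the pick
  -- included, has the same chance to be in `R`.
  play h X := (randomSubset X (H - 1)).map fun R => (recommend h X, insert (recommend h X) R)
  pick_mem h X _ o ho := by
    rw [PMF.support_map] at ho
    obtain ⟨R, -, rfl⟩ := ho
    exact Finset.mem_insert_self _ _
  list_subset h X hX o ho := by
    rw [PMF.support_map] at ho
    obtain ⟨R, hR, rfl⟩ := ho
    exact Finset.insert_subset (recommend_mem h hX) (mem_support_randomSubset.1 hR).1
  list_card h X hX o ho := by
    rw [PMF.support_map] at ho
    obtain ⟨R, hR, rfl⟩ := ho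
    have h1 := (mem_support_randomSubset.1 hR).2
    have h2 := Finset.card_insert_le (recommend h X) R
    have h3 := min_le_left (H - 1) X.card
    dsimp only
    omega

open Classical in
/-- The next round after `h` when the random part of the list is `R`. -/
noncomputable def nextRound (env : Environment d A) (h : History d) (R : Finset (Vec d)) :
    Round d where
  actions := env.actions h
  pick := recommend h (env.actions h)
  list := insert (recommend h (env.actions h)) R
  feedback := env.feedback h (recommend h (env.actions h))
    (insert (recommend h (env.actions h)) R)

theorem historyLaw_guessLearner_succ (hH : 1 ≤ H) (env : Environment d A) (T : ℕ) :
    historyLaw (guessLearner d hH) env (T + 1) =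
      (historyLaw (guessLearner d hH) env T).bind fun h =>
        (randomSubset (env.actions h) (H - 1)).map fun R => nextRound env h R :: h := by
  rw [historyLaw]
  congr 1
  funext h
  rw [guessLearner, PMF.map_comp]
  rfl

theorem tsum_historyLaw_succ (hH : 1 ≤ H) (env : Environment d A) (T : ℕ)
    (F : History d → ℝ≥0∞) :
    ∑' h, historyLaw (guessLearner d hH) env (T + 1) h * F h =
      ∑' h, historyLaw (guessLearner d hH) env T h *
        ∑' R, randomSubset (env.actions h) (H - 1) R * F (nextRound env h R :: h) := by
  rw [historyLaw_guessLearner_succ, tsum_bind_mul]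
  simp_rw [tsum_map_mul]

theorem nextRound_list_subset (env : Environment d A) (h : History d) {R : Finset (Vec d)}
    (hR : R ⊆ env.actions h) : (nextRound env h R).list ⊆ env.actions h :=
  Finset.insert_subset (recommend_mem h (env.actions_nonempty h)) hR

theorem nextRound_pick_mem (env : Environment d A) (h : History d) (R : Finset (Vec d)) :
    (nextRound env h R).pick ∈ (nextRound env h R).list :=
  Finset.mem_insert_self _ _

theorem inner_le_nextRound_feedback (env : Environment d A) (h : History d) {R : Finset (Vec d)}
    (hR : R ⊆ env.actions h) {y : Vec d} (hy : y ∈ (nextRound env h R).list) :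
    inner ℝ y env.hidden ≤ inner ℝ (nextRound env h R).feedback env.hidden :=
  env.feedback_best h _ _ (nextRound_pick_mem env h R) (nextRound_list_subset env h hR) y hy

theorem consistent_cons_nextRound {env : Environment d A} {h : History d} {R : Finset (Vec d)}
    (hc : Consistent env.hidden h) (hR : R ⊆ env.actions h) :
    Consistent env.hidden (nextRound env h R :: h) := by
  have hf : (nextRound env h R).feedback ∈ env.actions h :=
    env.feedback_mem h _ _ (nextRound_pick_mem env h R) (nextRound_list_subset env h hR)
  have hp : (nextRound env h R).pick ∈ env.actions h :=
    nextRound_list_subset env h hR (nextRound_pick_mem env h R)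
  refine ⟨hc, ?_, ?_, ?_⟩
  · have := norm_sub_le (nextRound env h R).feedback (nextRound env h R).pick
    have := env.actions_ball h _ hf
    have := env.actions_ball h _ hp
    rw [Round.cut]
    linarith
  · rw [Round.cut, inner_sub_left, sub_nonpos]
    exact inner_guess_le_recommend h hf
  · rw [Round.cut, inner_sub_left, sub_nonneg]
    exact inner_le_nextRound_feedback env h hR (nextRound_pick_mem env h R)

theorem consistent_of_mem_support (hH : 1 ≤ H) (env : Environment d A) (T : ℕ) :
    ∀ h ∈ (historyLaw (guessLearner d hH) env T).support, Consistent env.hidden h := by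
  induction T with
  | zero =>
    intro h hh
    rw [historyLaw, PMF.mem_support_pure_iff] at hh
    subst hh
    trivial
  | succ T ih =>
    intro h' hh'
    rw [historyLaw_guessLearner_succ, PMF.mem_support_bind_iff] at hh'
    obtain ⟨h, hh, hm⟩ := hh'
    rw [PMF.support_map] at hm
    obtain ⟨R, hR, rfl⟩ := hm
    exact consistent_cons_nextRound (ih h hh) (mem_support_randomSubset.1 hR).1

/-- In each round, the expected gain makes up for the loss, up to the factor `A / (H - 1)`. -/
theorem mul_roundLoss_le (hHA : H ≤ A) (env : Environment d A) (h : History d)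
    (R₀ : Finset (Vec d)) :
    ((H - 1 : ℕ) : ℝ≥0∞) * ENNReal.ofReal (roundLoss env.hidden (nextRound env h R₀)) ≤
      A * ∑' R, randomSubset (env.actions h) (H - 1) R *
        ENNReal.ofReal (inner ℝ (nextRound env h R).cut env.hidden) := by
  classical
  set w := env.hidden
  set X := env.actions h
  obtain ⟨x, hx, hmax⟩ := X.exists_max_image (fun x => inner ℝ x w) (env.actions_nonempty h)
  have hloss : roundLoss w (nextRound env h R₀) ≤ inner ℝ x w - inner ℝ (recommend h X) w := by
    refine sub_le_sub_right (csSup_le ((env.actions_nonempty h).to_set.image _) ?_) _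
    rintro _ ⟨y, hy, rfl⟩
    exact hmax y hy
  set D := ENNReal.ofReal (roundLoss w (nextRound env h R₀))
  calc ((H - 1 : ℕ) : ℝ≥0∞) * D
      ≤ (A * ∑' R, randomSubset X (H - 1) R * (if x ∈ R then 1 else 0)) * D := by
        gcongr
        exact le_mul_tsum_randomSubset hx (by omega) (env.actions_card h)
    _ = A * ∑' R, randomSubset X (H - 1) R * ((if x ∈ R then 1 else 0) * D) := by
        rw [mul_assoc, ← ENNReal.tsum_mul_right]
        simp_rw [mul_assoc]
    _ ≤ _ := by
        refine mul_le_mul_right (ENNReal.tsum_le_tsum fun R => ?_) _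
        by_cases hR : R ∈ (randomSubset X (H - 1)).support
        · refine mul_le_mul_right ?_ _
          -- If the best action `x` is listed, the feedback is at least as good as `x`, so the gain
          -- covers the loss; otherwise nonnegativity is enough.
          split_ifs with hxR
          · rw [one_mul]
            refine ENNReal.ofReal_le_ofReal (hloss.trans ?_)
            rw [Round.cut, inner_sub_left]
            exact sub_le_sub_right (inner_le_nextRound_feedback env h
              (mem_support_randomSubset.1 hR).1 (Finset.mem_insert_of_mem hxR)) _
          · simp
        · rw [PMF.mem_support_iff, not_not] at hR
          simp [hR]

/-- Sums the one-round comparison by conditioning on the past. Values in `ℝ≥0∞` avoid summability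
conditions. -/
theorem mul_expected_loss_le (hH : 1 ≤ H) (hHA : H ≤ A) (env : Environment d A) (T : ℕ) :
    ((H - 1 : ℕ) : ℝ≥0∞) * ∑' h, historyLaw (guessLearner d hH) env T h *
        (h.map fun ρ => ENNReal.ofReal (roundLoss env.hidden ρ)).sum ≤
      A * ∑' h, historyLaw (guessLearner d hH) env T h *
        (h.map fun ρ => ENNReal.ofReal (inner ℝ ρ.cut env.hidden)).sum := by
  induction T with
  | zero =>
    have : ∀ h : History d, historyLaw (guessLearner d hH) env 0 h *
        (h.map fun ρ => ENNReal.ofReal (roundLoss env.hidden ρ)).sum = 0 := by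
      intro h
      rw [historyLaw, PMF.pure_apply]
      split_ifs with h0
      · simp [h0]
      · simp
    simp [this]
  | succ T ih =>
    rw [tsum_historyLaw_succ, tsum_historyLaw_succ]
    simp only [List.map_cons, List.sum_cons, mul_add, ENNReal.tsum_add, ENNReal.tsum_mul_right,
      PMF.tsum_coe, one_mul]
    refine add_le_add ?_ ih
    rw [← ENNReal.tsum_mul_left, ← ENNReal.tsum_mul_left]
    refine ENNReal.tsum_le_tsum fun h => ?_
    -- The loss depends only on the pick, not on the random part of the list.
    have h1 : ∀ R, roundLoss env.hidden (nextRound env h R)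
        = roundLoss env.hidden (nextRound env h ∅) := fun R => rfl
    simp_rw [h1, ENNReal.tsum_mul_right, PMF.tsum_coe, one_mul]
    rw [mul_left_comm, mul_left_comm (A : ℝ≥0∞)]
    exact mul_le_mul_right (mul_roundLoss_le hHA env h ∅) _

theorem Consistent.sum_ofReal {w : Vec d} : ∀ {h : History d}, Consistent w h →
    0 ≤ gain w h ∧ (h.map fun ρ => ENNReal.ofReal (inner ℝ ρ.cut w)).sum
      = ENNReal.ofReal (gain w h)
  | [], _ => by simp [gain]
  | ρ :: h, hc => by
    obtain ⟨h1, h2⟩ := hc.1.sum_ofReal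
    have h3 : gain w (ρ :: h) = inner ℝ ρ.cut w + gain w h := by simp [gain]
    rw [h3, List.map_cons, List.sum_cons, h2, ENNReal.ofReal_add hc.2.2.2 h1]
    exact ⟨add_nonneg hc.2.2.2 h1, rfl⟩

theorem regret_le_toReal (w : Vec d) (h : History d) :
    (h.map fun ρ => ENNReal.ofReal (roundLoss w ρ)).sum ≠ ∞ ∧
      regret w h ≤ (h.map fun ρ => ENNReal.ofReal (roundLoss w ρ)).sum.toReal := by
  induction h with
  | nil => simp [regret]
  | cons ρ h ih =>
    have h3 : regret w (ρ :: h) = roundLoss w ρ + regret w h := by simp [regret]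
    rw [h3, List.map_cons, List.sum_cons]
    refine ⟨ENNReal.add_ne_top.2 ⟨ENNReal.ofReal_ne_top, ih.1⟩, ?_⟩
    rw [ENNReal.toReal_add ENNReal.ofReal_ne_top ih.1]
    exact add_le_add (by rw [ENNReal.toReal_ofReal']; exact le_max_left _ _) ih.2

theorem expectedRegret_guessLearner_le (hH : 2 ≤ H) (hHA : H ≤ A) (env : Environment d A)
    (T : ℕ) :
    expectedRegret (guessLearner d (one_le_two.trans hH)) env T ≤
      A / ((H : ℝ) - 1) * (132 * 64 ^ d) := by
  have hH1 : 1 ≤ H := one_le_two.trans hH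
  change expectedRegret (guessLearner d hH1) env T ≤ _
  set P := historyLaw (guessLearner d hH1) env T with hP
  set loss : History d → ℝ≥0∞ := fun h =>
    (h.map fun ρ => ENNReal.ofReal (roundLoss env.hidden ρ)).sum
  have hgain : ∑' h, P h * (h.map fun ρ => ENNReal.ofReal (inner ℝ ρ.cut env.hidden)).sum
      ≤ ENNReal.ofReal (132 * 64 ^ d) := by
    calc _ ≤ ∑' h, P h * ENNReal.ofReal (132 * 64 ^ d) := by
          refine ENNReal.tsum_le_tsum fun h => ?_
          by_cases hh : h ∈ P.support
          · have hc := consistent_of_mem_support hH1 env T h hh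
            rw [hc.sum_ofReal.2]
            exact mul_le_mul_right (ENNReal.ofReal_le_ofReal (gain_le env.hidden_ball hc)) _
          · rw [PMF.mem_support_iff, not_not] at hh
            simp [hh]
      _ = _ := by rw [ENNReal.tsum_mul_right, PMF.tsum_coe, one_mul]
  have hmain : ((H - 1 : ℕ) : ℝ≥0∞) * ∑' h, P h * loss h
      ≤ A * ENNReal.ofReal (132 * 64 ^ d) :=
    (mul_expected_loss_le hH1 hHA env T).trans (mul_le_mul_right hgain _)
  have hfin : (A : ℝ≥0∞) * ENNReal.ofReal (132 * 64 ^ d) ≠ ∞ := by finiteness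
  have hk0 : ((H - 1 : ℕ) : ℝ≥0∞) ≠ 0 := by
    rw [Nat.cast_ne_zero]; omega
  have hL : ∑' h, P h * loss h ≠ ∞ := by
    intro h
    rw [h, ENNReal.mul_top hk0] at hmain
    exact hfin (top_le_iff.1 hmain)
  have hreg : expectedRegret (guessLearner d hH1) env T ≤ (∑' h, P h * loss h).toReal := by
    rw [ENNReal.tsum_toReal_eq fun h => ENNReal.ne_top_of_tsum_ne_top hL h]
    refine (expectedRegret_summable _ env T).tsum_le_tsum (fun h => ?_) (ENNReal.summable_toReal hL)
    rw [ENNReal.toReal_mul]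
    exact mul_le_mul_of_nonneg_left (regret_le_toReal env.hidden h).2 ENNReal.toReal_nonneg
  have hreal := ENNReal.toReal_mono hfin hmain
  rw [ENNReal.toReal_mul, ENNReal.toReal_mul, ENNReal.toReal_natCast, ENNReal.toReal_natCast,
    ENNReal.toReal_ofReal (by positivity), Nat.cast_sub hH1, Nat.cast_one] at hreal
  have hpos : (0 : ℝ) < (H : ℝ) - 1 := by
    have : (2 : ℝ) ≤ H := by exact_mod_cast hH
    linarith
  refine hreg.trans ?_
  rw [div_mul_eq_mul_div, le_div_iff₀ hpos, mul_comm]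
  exact hreal

/-- At `d = 0` both sides are `1`, matching the convention for `exp (0 log 0)`. -/
theorem exp_mul_log_natCast (d : ℕ) : Real.exp ((d : ℝ) * Real.log d) = (d : ℝ) ^ d := by
  rcases Nat.eq_zero_or_pos d with rfl | hd
  · simp
  · rw [Real.exp_nat_mul, Real.exp_log (by exact_mod_cast hd)]

/-- One term of the exponential series gives `x ^ d ≤ exp x * d!`, and `d! ≤ d ^ d`. With `x = 64`
this turns the singly exponential bound into the stated form. -/
theorem pow_le_exp_mul_exp_mul_log {x : ℝ} (hx : 0 ≤ x) (d : ℕ) :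
    x ^ d ≤ Real.exp x * Real.exp ((d : ℝ) * Real.log d) := by
  have h1 := Real.pow_div_factorial_le_exp x hx d
  have h2 : ((d.factorial : ℕ) : ℝ) ≤ (d : ℝ) ^ d := by exact_mod_cast Nat.factorial_le_pow d
  rw [div_le_iff₀ (by positivity)] at h1
  rw [exp_mul_log_natCast]
  exact h1.trans (by gcongr)

end Learning

end LocalRec

theorem corollary6p2 :
    ∃ C : ℝ, 0 < C ∧
      ∀ d A H : ℕ, 2 ≤ H → H ≤ A →
        ∃ alg : LocalRec.Learner d H,
          ∀ (env : LocalRec.Environment d A) (T : ℕ),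
            LocalRec.expectedRegret alg env T ≤
              C * ((A : ℝ) / ((H : ℝ) - 1) * Real.exp ((d : ℝ) * Real.log (d : ℝ))) := by
  refine ⟨132 * Real.exp 64, by positivity, fun d A H hH hHA =>
    ⟨LocalRec.guessLearner d (one_le_two.trans hH), fun env T => ?_⟩⟩
  have hpos : (0 : ℝ) < (H : ℝ) - 1 := by
    have : (2 : ℝ) ≤ H := by exact_mod_cast hH
    linarith
  calc LocalRec.expectedRegret _ env T ≤ A / ((H : ℝ) - 1) * (132 * 64 ^ d) :=
        LocalRec.expectedRegret_guessLearner_le hH hHA env T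
    _ ≤ A / ((H : ℝ) - 1) * (132 * (Real.exp 64 * Real.exp ((d : ℝ) * Real.log d))) := by
        gcongr
        exact LocalRec.pow_le_exp_mul_exp_mul_log (by norm_num) d
    _ = _ := by ring
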